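/- Let $N \ge 0$ and let $\mathcal A = \{1,\dots,N\} \sqcup \{\bar 1,\dots,\bar N\}$ be the alphabet of unbarred and barred letters. Let $\lessdot$ be a shuffle order on $\mathcal A$, i.e. a total order with $1 \lessdot 2 \lessdot \cdots \lessdot N$ and $\bar 1 \lessdot \bar 2 \lessdot \cdots \lessdot \bar N$. Let $\mathcal U$ be the free associative $\mathbb Z$-algebra on the noncommuting variables $u_x$, $x \in \mathcal A$, in which a word $w_1 \cdots w_t$ in the alphabet $\mathcal A$ is identified with the monomial $u_{w_1} \cdots u_{w_t}$. The $\lessdot$-colored plactic algebra $\mathcal U / I^{\lessdot}_{\mathrm{plac}}$ is the quotient of $\mathcal U$ by the two-sided ideal generated by the relations - $xzy = zxy$ and $yxz = yzx$ for $x \lessdot y \lessdot z$ in $\mathcal A$; - $yyx = yxy$ for $x \lessdot y$ and $zyy = yzy$ for $y \lessdot z$, where $y$ is unbarred; - $yyz = yzy$ for $y \lessdot z$ and $xyy = yxy$ for $x \lessdot y$, where $y$ is barred. For $k \ge 1$ let $e^{\lessdot}_k(\mathbf u) = \sum u_{z_1} u_{z_2} \cdots u_{z_k}$, summed over all $z_1,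 \dots, z_k \in \mathcal A$ such that for every $1 \le i < k$ either $z_{i+1} \lessdot z_i$, or $z_i$ and $z_{i+1}$ are equal barred letters; put $e^{\lessdot}_0(\mathbf u) = 1$ and $e^{\lessdot}_k(\mathbf u) = 0$ for $k < 0$. For a partition $\nu$ with conjugate partition $\nu'$ and $t = \nu_1$, the noncommutative super Schur function is $$\mathfrak J^{\lessdot}_\nu(\mathbf u) = \sum_{\pi \in S_t} \operatorname{sgn}(\pi)\, e^{\lessdot}_{\nu'_1 + \pi(1) - 1}(\mathbf u)\, e^{\lessdot}_{\nu'_2 + \pi(2) - 2}(\mathbf u) \cdots e^{\lessdot}_{\nu'_t + \pi(t) - t}(\mathbf u) \in \mathcal U .$$ A $\lessdot$-colored tableau of shape $\nu$ is a filling of the Young diagram of $\nu$ (in English notation) by letters of $\mathcal A$ such that each row and each column is weakly increasing for $\lessdot$, while the unbarred letters in each column and the barred letters in each row are strictly increasing. Let $\mathrm{CT}^{\lessdot}_\nu$ be the set of these tableaux. The column reading word $\mathrm{creading}(T)$ is obtained by concatenating the columns of $T$ from left to right, each read from bottom to top. **Theorem.** For every shuffle order $\lessdot$ on $\mathcal A$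 and every partition $\nu$, $$\mathfrak J^{\lessdot}_\nu(\mathbf u) = \sum_{T \in \mathrm{CT}^{\lessdot}_\nu} \mathrm{creading}(T) \qquad \text{in } \mathcal U / I^{\lessdot}_{\mathrm{plac}} .$$ -/

import Mathlib

namespace SuperSchur

/-- The alphabet `{1, …, N} ⊔ {1̄, …, N̄}`: the summand `Sum.inl a` is the unbarred letter `a`,
and `Sum.inr a` is the barred letter `ā` (with `Fin N` standing for `{1, …, N}`). -/
abbrev Letter (N : ℕ) : Type := Fin N ⊕ Fin N

/-- A colored word is a word in the alphabet of all letters. -/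
abbrev ColoredWord (N : ℕ) : Type := List (Letter N)

/-- `lt` is (the strict part of) a shuffle order: a total order on the alphabet
that restricts to the usual order on the unbarred letters and on the barred letters. -/
structure IsShuffleOrder {N : ℕ} (lt : Letter N → Letter N → Prop) : Prop where
  irrefl : ∀ x, ¬ lt x x
  trans : ∀ x y z, lt x y → lt y z → lt x z
  total : ∀ x y, lt x y ∨ x = y ∨ lt y x
  unbarred_lt : ∀ a b : Fin N, a < b → lt (Sum.inl a) (Sum.inl b)
  barred_lt : ∀ a b : Fin N, a < b → lt (Sum.inr a) (Sum.inr b)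

/-- The free associative `ℤ`-algebra on noncommuting variables indexed by the letters. -/
abbrev U (N : ℕ) : Type := FreeAlgebra ℤ (Letter N)

/-- The monomial `u_{w₁} ⋯ u_{wₜ}` of a colored word `w = w₁ ⋯ wₜ`. -/
noncomputable def monomial {N : ℕ} (w : ColoredWord N) : U N :=
  (w.map (FreeAlgebra.ι ℤ)).prod

/-- The defining relations of the colored plactic algebra. -/
inductive PlacticRel {N : ℕ} (lt : Letter N → Letter N → Prop) : U N → U N → Prop
  | xzy_zxy (x y z : Letter N) : lt x y → lt y z →
      PlacticRel lt (monomial [x, z, y]) (monomial [z, x, y])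
  | yxz_yzx (x y z : Letter N) : lt x y → lt y z →
      PlacticRel lt (monomial [y, x, z]) (monomial [y, z, x])
  | unbarred_yyx (x : Letter N) (b : Fin N) : lt x (Sum.inl b) →
      PlacticRel lt (monomial [Sum.inl b, Sum.inl b, x]) (monomial [Sum.inl b, x, Sum.inl b])
  | unbarred_zyy (z : Letter N) (b : Fin N) : lt (Sum.inl b) z →
      PlacticRel lt (monomial [z, Sum.inl b, Sum.inl b]) (monomial [Sum.inl b, z, Sum.inl b])
  | barred_yyz (z : Letter N) (b : Fin N) : lt (Sum.inr b) z →
      PlacticRel lt (monomial [Sum.inr b, Sum.inr b, z]) (monomial [Sum.inr b, z, Sum.inr b])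
  | barred_xyy (x : Letter N) (b : Fin N) : lt x (Sum.inr b) →
      PlacticRel lt (monomial [x, Sum.inr b, Sum.inr b]) (monomial [Sum.inr b, x, Sum.inr b])

/-- The colored plactic algebra: the quotient of `U N` by the two-sided ideal generated by
the colored plactic relations. -/
abbrev PlacticAlgebra {N : ℕ} (lt : Letter N → Letter N → Prop) : Type :=
  RingQuot (PlacticRel lt)

/-- The quotient map from `U N` to the colored plactic algebra. -/
noncomputable def toPlactic {N : ℕ} (lt : Letter N → Letter N → Prop) :
    U N →ₐ[ℤ] PlacticAlgebra lt :=
  RingQuot.mkAlgHom ℤ (PlacticRel lt)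

/-- `ColGT lt y x`: either `y` is greater than `x`, or `y` and `x` are equal barred letters. -/
def ColGT {N : ℕ} (lt : Letter N → Letter N → Prop) (y x : Letter N) : Prop :=
  lt x y ∨ (y = x ∧ y.isRight = true)

open Classical in
/-- The noncommutative super elementary symmetric function `e_k` for an integer `k`: the sum of the
monomials of the words `z₁ ⋯ z_k` with `ColGT lt zᵢ zᵢ₊₁` for all `i < k`
(which is `1` for `k = 0`), and `0` for `k < 0`. -/
noncomputable def elementary {N : ℕ} (lt : Letter N → Letter N → Prop) : ℤ → U N
  | Int.ofNat k =>
      ∑ z : Fin k → Letter N with (List.ofFn z).IsChain (ColGT lt), monomial (List.ofFn z)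
  | Int.negSucc _ => 0

/-- The noncommutative super Schur function of a partition `ν`, given as a Young diagram (with
`ν.rowLen 0` columns, of lengths `ν.colLen j`):
`∑_π sgn(π) e_{ν'₁ + π(1) - 1} ⋯ e_{ν'ₜ + π(t) - t}`, the product being taken from left to right. -/
noncomputable def superSchur {N : ℕ} (lt : Letter N → Letter N → Prop) (ν : YoungDiagram) : U N :=
  ∑ π : Equiv.Perm (Fin (ν.rowLen 0)),
    ((Equiv.Perm.sign π : ℤˣ) : ℤ) •
      (List.ofFn fun j : Fin (ν.rowLen 0) =>
        elementary lt ((ν.colLen j : ℤ) + ((π j : ℕ) : ℤ) - ((j : ℕ) : ℤ))).prod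

/-- A filling `T` of the cells `(row, column)` of `ν` by letters is a colored tableau: rows and
columns are weakly increasing, and the unbarred letters in each column and the barred letters in
each row are strictly increasing. -/
structure IsColoredTableau {N : ℕ} (lt : Letter N → Letter N → Prop) (ν : YoungDiagram)
    (T : ν.cells → Letter N) : Prop where
  row_weak : ∀ c d : ν.cells, c.1.1 = d.1.1 → c.1.2 < d.1.2 → lt (T c) (T d) ∨ T c = T d
  col_weak : ∀ c d : ν.cells, c.1.2 = d.1.2 → c.1.1 < d.1.1 → lt (T c) (T d) ∨ T c = T d
  row_strict : ∀ c d : ν.cells, c.1.1 = d.1.1 → c.1.2 < d.1.2 →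
    (T c).isRight = true → (T d).isRight = true → lt (T c) (T d)
  col_strict : ∀ c d : ν.cells, c.1.2 = d.1.2 → c.1.1 < d.1.1 →
    (T c).isLeft = true → (T d).isLeft = true → lt (T c) (T d)

open Classical in
/-- The finite set of colored tableaux of shape `ν`. -/
noncomputable def coloredTableaux {N : ℕ} (lt : Letter N → Letter N → Prop) (ν : YoungDiagram) :
    Finset (ν.cells → Letter N) :=
  {T | IsColoredTableau lt ν T}

/-- The column reading word: concatenate the columns from left to right, each read
from bottom to top. -/
def columnReading {N : ℕ} {ν : YoungDiagram} (T : ν.cells → Letter N) : ColoredWord N :=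
  (List.ofFn fun j : Fin (ν.rowLen 0) =>
    List.ofFn fun i : Fin (ν.colLen j) =>
      T ⟨((i.rev : ℕ), (j : ℕ)), YoungDiagram.mem_iff_lt_colLen.mpr i.rev.isLt⟩).flatten

end SuperSchur

/-!
Let `G y x` say that `y` may stand immediately below `x` in a column; then `¬ G x y` says that `y`
may stand immediately to the right of `x` in a row, and in terms of `G` the relations for barred and
unbarred letters become the same two Knuth relations.

These relations imply that the elementary functions commute. Removing the top letter `x` of the
alphabet, one has to show that `e_p(below x) * [x, e_{q+1}(B)]` is symmetric in `p` and `q`. Compare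
a column `C` of the first factor with a column `D` of the second. If `D` fits to the right of `C`,
the contribution vanishes. Otherwise, let `d` be the entry of `D` in the first failing row. The
parts of `C` and `D` below this row range independently over the columns of letters below `d`, their
sums can be moved to the front, and they commute by induction.

Once the elementary functions commute, the determinant is the signed sum over permutations `σ`
of the lists of columns whose `j`-th length is `γ (σ j) + j`, where `γ j = ν'_j - j`. Exchanging the
tails of two adjacent columns below the rightmost failure of the topmost failing row multiplies `σ`
by a transposition and preserves the position of that failure. Hence only the lists without
failures survive. Their lengths decrease weakly, so `σ = 1`, and they are the column lists of the
tableaux.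
-/

namespace SuperSchur

section ColumnOrders

variable {A : Type*} {G : A → A → Prop}

/-- A relation on letters, where `G y x` means that `y` may stand immediately below `x` in a column,
and `¬ G x y` that `y` may stand immediately to the right of `x` in a row. Letters with `G x x` are
those which may be repeated in columns (the barred ones), the others may be repeated in rows. -/
class IsColumnOrder (G : A → A → Prop) : Prop extends
  IsTrans A G, Std.Antisymm G, Std.Trichotomous G

/-- The Knuth relations for a family of elements of a monoid. -/
structure KnuthRelations {Q : Type*} [Monoid Q] (G : A → A → Prop) (u : A → Q) : Prop where
  swap_left : ∀ {x y z}, ¬ G x y → G z y → u x * u z * u y = u z * u x * u y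
  swap_right : ∀ {x y z}, G y x → ¬ G y z → u y * u x * u z = u y * u z * u x

theorem not_rel_of_not_rel_of_rel [IsTrans A G] {x y z : A} (h : ¬ G x y) (h' : G z y) :
    ¬ G x z :=
  fun hxz => h (_root_.trans hxz h')

theorem rel_of_not_rel_of_rel [IsTrans A G] [Std.Trichotomous G] {x y z : A} (h : ¬ G x y)
    (h' : G z y) : G z x := by
  by_contra hzx
  by_cases hxz : G x z
  · exact h (_root_.trans hxz h')
  · exact h (Std.Trichotomous.trichotomous z x hzx hxz ▸ h')

theorem exists_top [IsTrans A G] [Std.Trichotomous G] {S : Finset A} (hS : S.Nonempty) :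
    ∃ x ∈ S, ∀ y ∈ S, y ≠ x → G y x := by
  induction hS using Finset.Nonempty.cons_induction with
  | singleton x => exact ⟨x, by simp, by simp⟩
  | cons z S _ _ ih =>
    obtain ⟨x, hx, hxS⟩ := ih
    by_cases hzx : z = x ∨ G z x
    · refine ⟨x, Finset.mem_cons_of_mem hx, fun y hy hyx => ?_⟩
      obtain rfl | hy := Finset.mem_cons.1 hy
      · exact hzx.resolve_left hyx
      · exact hxS y hy hyx
    · have hxz : G x z := by
        by_contra hxz
        exact hzx (.inl (Std.Trichotomous.trichotomous z x (fun h => hzx (.inr h)) hxz))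
      refine ⟨z, Finset.mem_cons_self z S, fun y hy hyz => ?_⟩
      have hy := (Finset.mem_cons.1 hy).resolve_left hyz
      by_cases hyx : y = x
      · exact hyx ▸ hxz
      · exact _root_.trans (hxS y hy hyx) hxz

end ColumnOrders

section Words

variable {A Q : Type*} [Monoid Q] {G : A → A → Prop} {u : A → Q}

/-- The product of the variables along a word. -/
def wordProd (u : A → Q) (w : List A) : Q := (w.map u).prod

@[simp] theorem wordProd_nil : wordProd u [] = 1 := rfl

@[simp] theorem wordProd_cons (x : A) (w : List A) :
    wordProd u (x :: w) = u x * wordProd u w :=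
  List.prod_cons

@[simp] theorem wordProd_append (v w : List A) :
    wordProd u (v ++ w) = wordProd u v * wordProd u w := by
  simp [wordProd]

/-- The word `Y` is at most as long as `Z`, and each letter of `Z` may stand in a row to the right
of the letter of `Y` at the same position. -/
def RowPaired (G : A → A → Prop) : List A → List A → Prop
  | [], _ => True
  | _ :: _, [] => False
  | y :: Y, z :: Z => ¬ G y z ∧ RowPaired G Y Z

theorem RowPaired.of_forall₂ {Y Z : List A} (h : List.Forall₂ (fun y z => ¬ G y z) Y Z) :
    RowPaired G Y Z := by
  induction h with
  | nil => trivial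
  | cons hyz _ ih => exact ⟨hyz, ih⟩

variable [IsTrans A G]

theorem RowPaired.shift {Y Z : List A} {z : A} (h : RowPaired G Y Z) (hz : (z :: Z).IsChain G) :
    RowPaired G Y (z :: Z) := by
  induction Y generalizing Z z with
  | nil => trivial
  | cons y Y ih =>
    cases Z with
    | nil => exact h.elim
    | cons z' Z =>
      rw [List.isChain_cons_cons] at hz
      exact ⟨not_rel_of_not_rel_of_rel h.1 hz.1, ih h.2 hz.2⟩

theorem wordProd_mul_comm_of_rowPaired (hu : KnuthRelations G u) {Y Z : List A} {w : A}
    (h : RowPaired G Y Z) (hw : (w :: Z).IsChain G) :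
    wordProd u Y * u w * wordProd u Z = u w * wordProd u Y * wordProd u Z := by
  induction Y generalizing Z w with
  | nil => simp
  | cons y Y ih =>
    cases Z with
    | nil => exact h.elim
    | cons z Z =>
      rw [List.isChain_cons_cons] at hw
      have hYw := ih (h.2.shift hw.2) (List.isChain_cons_cons.2 hw)
      have hYz := ih h.2 hw.2
      have hyw := hu.swap_left h.1 hw.1
      simp only [wordProd_cons, mul_assoc] at hYw hYz hyw ⊢
      rw [hYw, hYz, ← mul_assoc (u w) (u z), ← mul_assoc (u y), hyw]
      simp only [mul_assoc]

theorem mul_wordProd_mul_of_isChain (hu : KnuthRelations G u) {Y : List A} {y z : A}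
    (hy : (y :: Y).IsChain G) (hz : ¬ G y z) :
    u y * wordProd u Y * u z = u y * u z * wordProd u Y := by
  induction Y generalizing y with
  | nil => simp
  | cons y' Y ih =>
    rw [List.isChain_cons_cons] at hy
    have hy'z := ih hy.2 fun h => hz (_root_.trans hy.1 h)
    calc u y * wordProd u (y' :: Y) * u z
        = u y * (u y' * wordProd u Y * u z) := by simp only [wordProd_cons, mul_assoc]
      _ = u y * u y' * u z * wordProd u Y := by rw [hy'z]; simp only [mul_assoc]
      _ = u y * u z * wordProd u (y' :: Y) := by
        rw [hu.swap_right hy.1 hz, wordProd_cons, ← mul_assoc]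

theorem wordProd_mul_comm_of_forall₂ (hu : KnuthRelations G u) {Y Z : List A} {x : A}
    (hY : (Y ++ [x]).IsChain G) (h : List.Forall₂ (fun y z => ¬ G y z) Y Z) :
    wordProd u Y * (u x * wordProd u Z) = wordProd u Y * (wordProd u Z * u x) := by
  induction h with
  | nil => simp
  | @cons y z Y Z hyz _ ih =>
    have hYx := mul_wordProd_mul_of_isChain hu (Y := Y ++ [x]) hY hyz
    have hYz := mul_wordProd_mul_of_isChain hu (List.IsChain.left_of_append (l₂ := [x]) hY) hyz
    simp only [wordProd_append, wordProd_cons, wordProd_nil, mul_one] at hYx ⊢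
    calc u y * wordProd u Y * (u x * (u z * wordProd u Z))
        = u y * (wordProd u Y * u x) * u z * wordProd u Z := by simp only [mul_assoc]
      _ = u y * u z * (wordProd u Y * (u x * wordProd u Z)) := by
        rw [hYx]; simp only [mul_assoc]
      _ = u y * u z * wordProd u Y * (wordProd u Z * u x) := by
        rw [ih hY.tail, ← mul_assoc]
      _ = u y * wordProd u Y * (u z * wordProd u Z * u x) := by
        rw [← hYz]; simp only [mul_assoc]

/-- The product of the variables along the reading word of a column, which is listed from top to
bottom but read from bottom to top. -/
def colProd (u : A → Q) (C : List A) : Q := wordProd u C.reverse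

@[simp] theorem colProd_nil : colProd u [] = 1 := rfl

@[simp] theorem colProd_cons (x : A) (C : List A) : colProd u (x :: C) = colProd u C * u x := by
  simp [colProd]

theorem colProd_append (C D : List A) : colProd u (C ++ D) = colProd u D * colProd u C := by
  simp [colProd]

end Words

section Columns

variable {A Q : Type*} [Fintype A] {G : A → A → Prop} {u : A → Q}

open Classical in
/-- The finite set of letters that may stand below `x` in a column. -/
noncomputable def below (G : A → A → Prop) (x : A) : Finset A := {y | G y x}

@[simp] theorem mem_below {x y : A} : y ∈ below G x ↔ G y x := by
  simp [below]

theorem below_subset_below_of_not_rel [IsTrans A G] [Std.Trichotomous G] {c d : A}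
    (h : ¬ G c d) :
    below G d ⊆ below G c := fun _ hw =>
  mem_below.2 (rel_of_not_rel_of_rel h (mem_below.1 hw))

theorem below_subset_below_of_rel [IsTrans A G] {c d : A} (h : G d c) :
    below G d ⊆ below G c := fun _ hw =>
  mem_below.2 (_root_.trans (mem_below.1 hw) h)

open Classical in
/-- The finite set of columns of length `k`, listed from top to bottom, whose top letter (if any)
belongs to `S`. -/
noncomputable def columns (G : A → A → Prop) : ℕ → Finset A → Finset (List A)
  | 0, _ => {[]}
  | k + 1, S => S.biUnion fun x => (columns G k (below G x)).image (x :: ·)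

theorem columns_zero (S : Finset A) : columns G 0 S = {[]} := rfl

theorem mem_columns {k : ℕ} {S : Finset A} {C : List A} :
    C ∈ columns G k S ↔
      C.length = k ∧ C.IsChain (fun x y => G y x) ∧ ∀ x ∈ C.head?, x ∈ S := by
  induction k generalizing S C with
  | zero => cases C <;> simp [columns]
  | succ k ih =>
    cases C with
    | nil => simp [columns]
    | cons x C =>
      simp only [columns, Finset.mem_biUnion, Finset.mem_image, ih, List.isChain_cons, mem_below]
      aesop

theorem cons_mem_columns {k : ℕ} {S : Finset A} {x : A} {C : List A} :
    x :: C ∈ columns G (k + 1) S ↔ x ∈ S ∧ C ∈ columns G k (below G x) := by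
  simp only [mem_columns, List.isChain_cons, mem_below]
  aesop

theorem length_of_mem_columns {k : ℕ} {S : Finset A} {C : List A} (h : C ∈ columns G k S) :
    C.length = k :=
  (mem_columns.1 h).1

theorem isChain_of_mem_columns {k : ℕ} {S : Finset A} {C : List A} (h : C ∈ columns G k S) :
    C.IsChain (fun x y => G y x) :=
  (mem_columns.1 h).2.1

theorem sum_columns_succ [AddCommMonoid Q] (k : ℕ) (S : Finset A) (f : List A → Q) :
    ∑ C ∈ columns G (k + 1) S, f C = ∑ x ∈ S, ∑ C ∈ columns G k (below G x), f (x :: C) := by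
  classical
  rw [columns, Finset.sum_biUnion]
  · exact Finset.sum_congr rfl fun x _ => Finset.sum_image (by simp)
  · intro x _ y _ hxy
    simp only [Function.onFun, Finset.disjoint_left, Finset.mem_image]
    rintro _ ⟨C, _, rfl⟩ ⟨D, _, hD⟩
    exact hxy (List.cons.inj hD).1.symm

open Classical in
theorem sum_columns_below [AddCommMonoid Q] {k : ℕ} {S : Finset A} {d : A} (hS : below G d ⊆ S)
    (f : List A → Q) :
    ∑ C ∈ columns G k (below G d), f C =
      ∑ C ∈ columns G k S with ∀ c ∈ C.head?, G c d, f C := by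
  refine Finset.sum_congr (Finset.ext fun C => ?_) fun _ _ => rfl
  simp only [Finset.mem_filter, mem_columns, mem_below]
  exact ⟨fun h => ⟨⟨h.1, h.2.1, fun c hc => hS (mem_below.2 (h.2.2 c hc))⟩, h.2.2⟩,
    fun h => ⟨h.1.1, h.1.2.1, h.2⟩⟩

variable [Semiring Q]

/-- The noncommutative analogue of the elementary symmetric polynomial of degree `k`: the sum of
the reading words of the columns of length `k` whose top letter belongs to `S`. -/
noncomputable def columnSum (G : A → A → Prop) (u : A → Q) (k : ℕ) (S : Finset A) : Q :=
  ∑ C ∈ columns G k S, colProd u C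

@[simp] theorem columnSum_zero (S : Finset A) : columnSum G u 0 S = 1 := by
  simp only [columnSum, columns_zero, Finset.sum_singleton, colProd_nil]

theorem columnSum_succ (k : ℕ) (S : Finset A) :
    columnSum G u (k + 1) S = ∑ x ∈ S, columnSum G u k (below G x) * u x := by
  simp only [columnSum, sum_columns_succ, colProd_cons, Finset.sum_mul]

theorem columnSum_succ_eq_add [DecidableEq A] (k : ℕ) {S : Finset A} {x : A} (hx : x ∈ S) :
    columnSum G u (k + 1) S =
      columnSum G u (k + 1) (S.erase x) + columnSum G u k (below G x) * u x := by
  rw [columnSum_succ, columnSum_succ, Finset.sum_erase_add _ _ hx]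

theorem wordProd_mul_columnSum [IsTrans A G] (hu : KnuthRelations G u) (k : ℕ) {S : Finset A}
    {Y Z : List A} (h : RowPaired G Y Z) (hS : ∀ w ∈ S, (w :: Z).IsChain G) :
    wordProd u Y * columnSum G u k S * wordProd u Z =
      columnSum G u k S * wordProd u Y * wordProd u Z := by
  induction k generalizing S Z with
  | zero => simp
  | succ k ih =>
    simp only [columnSum_succ, Finset.mul_sum, Finset.sum_mul]
    refine Finset.sum_congr rfl fun w hw => ?_
    have hbelow := ih (S := below G w) (h.shift (hS w hw)) fun v hv =>
      List.isChain_cons_cons.2 ⟨mem_below.1 hv, hS w hw⟩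
    have hletter := wordProd_mul_comm_of_rowPaired hu h (hS w hw)
    simp only [wordProd_cons, mul_assoc] at hbelow hletter ⊢
    rw [hbelow, hletter]

theorem sum_colProd_mul_colProd [IsTrans A G] (hu : KnuthRelations G u) {Y Z : List A} {d : A}
    (h : RowPaired G Y (d :: Z)) (hZ : (d :: Z).IsChain G) (p q : ℕ) :
    ∑ C ∈ columns G p (below G d), ∑ D ∈ columns G q (below G d),
        colProd u C * wordProd u Y * (colProd u D * wordProd u (d :: Z)) =
      columnSum G u p (below G d) * columnSum G u q (below G d) *
        (wordProd u Y * wordProd u (d :: Z)) := by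
  have hD := wordProd_mul_columnSum hu q h fun w hw =>
    List.isChain_cons_cons.2 ⟨mem_below.1 hw, hZ⟩
  simp only [← Finset.mul_sum, ← Finset.sum_mul, mul_assoc] at hD ⊢
  rw [← hD]
  rfl

end Columns

section FailingRows

variable {A : Type*} {G : A → A → Prop}

/-- The column `D` cannot stand to the right of the column `C` because of row `r`: either `C` has no
entry there although `D` has one, or the two entries are in the wrong order. -/
def FailsAt (G : A → A → Prop) (r : ℕ) (C D : List A) : Prop :=
  ∃ d ∈ D[r]?, ∀ c ∈ C[r]?, G c d

/-- Row `r` is the first row in which `D` cannot stand to the right of `C`. -/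
def FirstFailsAt (G : A → A → Prop) (r : ℕ) (C D : List A) : Prop :=
  FailsAt G r C D ∧ ∀ s < r, ¬ FailsAt G s C D

@[simp] theorem not_failsAt_nil_right (r : ℕ) (C : List A) : ¬ FailsAt G r C [] := by
  simp [FailsAt]

@[simp] theorem failsAt_zero_cons (C D : List A) (d : A) :
    FailsAt G 0 C (d :: D) ↔ ∀ c ∈ C.head?, G c d := by
  simp [FailsAt, List.head?_eq_getElem?]

@[simp] theorem failsAt_succ_cons (r : ℕ) (c d : A) (C D : List A) :
    FailsAt G (r + 1) (c :: C) (d :: D) ↔ FailsAt G r C D := by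
  simp [FailsAt]

theorem FailsAt.lt_length {r : ℕ} {C D : List A} (h : FailsAt G r C D) : r < D.length := by
  obtain ⟨d, hd, -⟩ := h
  exact (List.getElem?_eq_some_iff.1 hd).1

@[simp] theorem firstFailsAt_zero (C D : List A) : FirstFailsAt G 0 C D ↔ FailsAt G 0 C D := by
  simp [FirstFailsAt]

theorem firstFailsAt_succ_cons (r : ℕ) (c d : A) (C D : List A) :
    FirstFailsAt G (r + 1) (c :: C) (d :: D) ↔ ¬ G c d ∧ FirstFailsAt G r C D := by
  simp only [FirstFailsAt, Nat.forall_lt_succ_left', failsAt_zero_cons, failsAt_succ_cons,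
    List.head?_cons, Option.mem_some_iff, forall_eq']
  tauto

theorem not_firstFailsAt_succ_nil (r : ℕ) (D : List A) : ¬ FirstFailsAt G (r + 1) [] D := by
  rintro ⟨⟨d, hd, -⟩, hmin⟩
  cases D with
  | nil => simp at hd
  | cons e D => exact hmin 0 r.succ_pos (by simp)

theorem not_firstFailsAt_succ_singleton (r : ℕ) (C : List A) (d : A) :
    ¬ FirstFailsAt G (r + 1) C [d] := fun h => by
  simpa using h.1.lt_length

theorem exists_forall₂_of_not_failsAt {C D : List A} (h : ∀ r, ¬ FailsAt G r C D) :
    ∃ Y C', C = Y ++ C' ∧ List.Forall₂ (fun y z => ¬ G y z) Y D := by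
  induction D generalizing C with
  | nil => exact ⟨[], C, rfl, .nil⟩
  | cons d D ih =>
    cases C with
    | nil => exact absurd (by simp) (h 0)
    | cons c C =>
      obtain ⟨Y, C', rfl, hY⟩ := ih fun r hr => h (r + 1) (by simpa using hr)
      exact ⟨c :: Y, C', rfl, .cons (by simpa using h 0) hY⟩

open Classical in
theorem sum_ite_firstFailsAt {Q : Type*} [AddCommMonoid Q] {C D : List A} {M : ℕ}
    (hM : D.length ≤ M) (h : ∃ r, FailsAt G r C D) (w : Q) :
    ∑ r ∈ Finset.range M, (if FirstFailsAt G r C D then w else 0) = w := by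
  have hfirst : ∀ r, FirstFailsAt G r C D ↔ r = Nat.find h := fun r => by
    rw [eq_comm, Nat.find_eq_iff]; rfl
  simp [hfirst, (Nat.find_spec h).lt_length.trans_le hM]

variable [Fintype A] {Q : Type*} [AddCommMonoid Q]

open Classical in
theorem sum_firstFailsAt_zero {F : List A → List A → Q} {S S' : Finset A}
    (hS : ∀ d ∈ S', below G d ⊆ S) (p q : ℕ) :
    ∑ C ∈ columns G p S, ∑ D ∈ columns G (q + 1) S',
        (if FirstFailsAt G 0 C D then F C D else 0) =
      ∑ d ∈ S', ∑ C ∈ columns G p (below G d), ∑ D ∈ columns G q (below G d), F C (d :: D) := by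
  simp only [sum_columns_succ, firstFailsAt_zero, failsAt_zero_cons]
  rw [Finset.sum_comm]
  refine Finset.sum_congr rfl fun d hd => ?_
  rw [sum_columns_below (hS d hd), Finset.sum_filter]
  exact Finset.sum_congr rfl fun C _ => by split_ifs <;> simp

open Classical in
theorem sum_firstFailsAt_succ (F : List A → List A → Q) (S S' : Finset A) (r p q : ℕ) :
    ∑ C ∈ columns G (p + 1) S, ∑ D ∈ columns G (q + 1) S',
        (if FirstFailsAt G (r + 1) C D then F C D else 0) =
      ∑ c ∈ S, ∑ d ∈ S', if G c d then 0 else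
        ∑ C ∈ columns G p (below G c), ∑ D ∈ columns G q (below G d),
          if FirstFailsAt G r C D then F (c :: C) (d :: D) else 0 := by
  rw [sum_columns_succ]
  refine Finset.sum_congr rfl fun c _ => ?_
  simp only [sum_columns_succ q, firstFailsAt_succ_cons]
  rw [Finset.sum_comm]
  refine Finset.sum_congr rfl fun d _ => ?_
  split_ifs with hcd <;> simp [hcd]

open Classical in
/-- Exchanging the tails of two columns `C` and `D` below their first failing row `r`, where `D`
contributes its entry `d` in row `r` to the head, exchanges the pairs of lengths `(p, q + 1)` and
`(q, p + 1)`. -/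
theorem sum_firstFailsAt_symm [IsTrans A G] [Std.Trichotomous G]
    {F : List A → List A → Q} {S S' : Finset A} (hS : ∀ d ∈ S', below G d ⊆ S) (r : ℕ)
    (hF : ∀ Y Z d, Y ∈ columns G r S → Z ++ [d] ∈ columns G (r + 1) S' →
      List.Forall₂ (fun y z => ¬ G y z) Y Z → ∀ p q,
      ∑ C ∈ columns G p (below G d), ∑ D ∈ columns G q (below G d), F (Y ++ C) (Z ++ d :: D) =
      ∑ C ∈ columns G q (below G d), ∑ D ∈ columns G p (below G d), F (Y ++ C) (Z ++ d :: D))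
    (p q : ℕ) :
    ∑ C ∈ columns G p S, ∑ D ∈ columns G (q + 1) S',
        (if FirstFailsAt G r C D then F C D else 0) =
      ∑ C ∈ columns G q S, ∑ D ∈ columns G (p + 1) S',
        if FirstFailsAt G r C D then F C D else 0 := by
  induction r generalizing F S S' p q with
  | zero =>
    rw [sum_firstFailsAt_zero hS, sum_firstFailsAt_zero hS]
    exact Finset.sum_congr rfl fun d hd => hF [] [] d (by simp [columns_zero])
      (by simp [cons_mem_columns, columns_zero, hd]) .nil p q
  | succ r ih =>
    obtain _ | p := p <;> obtain _ | q := q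
    case succ.succ =>
      rw [sum_firstFailsAt_succ, sum_firstFailsAt_succ]
      refine Finset.sum_congr rfl fun c hc => Finset.sum_congr rfl fun d hd => ?_
      split_ifs with hcd
      · rfl
      · refine ih (fun e he => ?_) (fun Y Z e hY hZ hYZ p q => ?_) p q
        · exact (below_subset_below_of_rel (mem_below.1 he)).trans
            (below_subset_below_of_not_rel hcd)
        · exact hF (c :: Y) (d :: Z) e (cons_mem_columns.2 ⟨hc, hY⟩)
            (cons_mem_columns.2 ⟨hd, hZ⟩) (.cons hcd hYZ) p q
    all_goals simp [columns_zero, sum_columns_succ, not_firstFailsAt_succ_nil,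
      not_firstFailsAt_succ_singleton]

end FailingRows

section Commutation

theorem commute_of_eq_add_mul_self {Q : Type*} [Ring Q] {a b : ℕ → Q} {t : Q} (ha₀ : a 0 = 1)
    (ha : ∀ k, a (k + 1) = b (k + 1) + a k * t)
    (hb : ∀ p q, Commute (b (p + 1)) (b (q + 1)))
    (hab : ∀ p q, a p * (t * b (q + 1) - b (q + 1) * t) = a q * (t * b (p + 1) - b (p + 1) * t))
    (p q : ℕ) : Commute (a p) (a q) := by
  induction p generalizing q with
  | zero => exact ha₀ ▸ Commute.one_left _
  | succ p ihp =>
    induction q with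
    | zero => exact ha₀ ▸ Commute.one_right _
    | succ q ihq =>
      have h₀₀ := (ihp q).eq
      have h₀₁ := (ihp (q + 1)).eq
      have h₁₀ := ihq.eq
      have hbb := (hb p q).eq
      have hpq := hab p q
      have hbp : b (p + 1) = a (p + 1) - a p * t := eq_sub_of_add_eq (ha p).symm
      have hbq : b (q + 1) = a (q + 1) - a q * t := eq_sub_of_add_eq (ha q).symm
      rw [hbp, hbq] at hbb hpq
      rw [commute_iff_eq]
      linear_combination (norm := noncomm_ring) hbb + hpq + h₀₁ * t + h₁₀ * t - h₀₀ * t * t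

theorem commute_of_eq_add_mul {Q : Type*} [Ring Q] {a b : ℕ → Q} {t : Q} (ha₀ : a 0 = 1)
    (ha : ∀ k, a (k + 1) = b (k + 1) + b k * t) (hb : ∀ p q, Commute (b p) (b q))
    (hbt : ∀ k, t * b k * t = b k * t * t)
    (hab : ∀ p q, b p * (t * b (q + 1) - b (q + 1) * t) = b q * (t * b (p + 1) - b (p + 1) * t))
    (p q : ℕ) : Commute (a p) (a q) := by
  obtain _ | p := p
  · exact ha₀ ▸ Commute.one_left _
  obtain _ | q := q
  · exact ha₀ ▸ Commute.one_right _
  have h₀₀ := (hb p q).eq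
  have h₀₁ := (hb p (q + 1)).eq
  have h₁₀ := (hb (p + 1) q).eq
  have h₁₁ := (hb (p + 1) (q + 1)).eq
  rw [commute_iff_eq, ha, ha]
  linear_combination (norm := noncomm_ring) h₁₁ + hab p q + h₀₁ * t + h₁₀ * t +
    b p * hbt q - b q * hbt p + h₀₀ * t * t

variable {A : Type*} {G : A → A → Prop}

theorem forall₂_cons_concat [IsTrans A G] {x d : A} {Y Z : List A}
    (h : List.Forall₂ (fun y z => ¬ G y z) Y Z)
    (hZ : (Z ++ [d]).IsChain (fun y z => G z y)) (hx : ∀ z ∈ (Z ++ [d]).head?, ¬ G x z) :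
    List.Forall₂ (fun y z => ¬ G y z) (x :: Y) (Z ++ [d]) := by
  induction h generalizing x with
  | nil => exact .cons (hx d rfl) .nil
  | @cons y z Y Z hyz _ ih =>
    have hZ := List.isChain_cons.1 hZ
    exact .cons (hx z rfl) <| ih hZ.2 fun z' hz' => not_rel_of_not_rel_of_rel hyz (hZ.1 z' hz')

theorem isChain_cons_reverse {Z : List A} {d : A}
    (hZ : (Z ++ [d]).IsChain (fun y z => G z y)) : (d :: Z.reverse).IsChain G := by
  rw [← List.isChain_reverse] at hZ
  simpa using hZ

theorem rowPaired_reverse_cons [IsTrans A G] {d : A} {Y Z : List A}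
    (h : List.Forall₂ (fun y z => ¬ G y z) Y Z)
    (hZ : (Z ++ [d]).IsChain (fun y z => G z y)) :
    RowPaired G Y.reverse (d :: Z.reverse) :=
  (RowPaired.of_forall₂ (List.forall₂_reverse_iff.2 h)).shift (isChain_cons_reverse hZ)

theorem rowPaired_reverse_concat [IsTrans A G] {x d : A} {Y Z : List A}
    (h : List.Forall₂ (fun y z => ¬ G y z) Y Z)
    (hZ : (Z ++ [d]).IsChain (fun y z => G z y)) (hx : ∀ z ∈ (Z ++ [d]).head?, ¬ G x z) :
    RowPaired G (Y.reverse ++ [x]) (d :: Z.reverse) := by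
  have h' := RowPaired.of_forall₂ (List.forall₂_reverse_iff.2 (forall₂_cons_concat h hZ hx))
  simpa using h'

theorem mem_of_mem_columns [Fintype A] [IsTrans A G] {S : Finset A}
    (hS : ∀ d ∈ S, below G d ⊆ S)
    {k : ℕ} {C : List A} (hC : C ∈ columns G k S) : ∀ c ∈ C, c ∈ S := by
  induction k generalizing S C with
  | zero => simp_all [columns_zero]
  | succ k ih =>
    cases C with
    | nil => simp
    | cons x C =>
      obtain ⟨hx, hC⟩ := cons_mem_columns.1 hC
      have hCx := ih (fun d hd => below_subset_below_of_rel (mem_below.1 hd)) hC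
      exact List.forall_mem_cons.2 ⟨hx, fun c hc => hS x hx (hCx c hc)⟩

variable {Q : Type*} [Fintype A] [Ring Q] {u : A → Q}

theorem colProd_mul_commutator_eq_zero [IsTrans A G] (hu : KnuthRelations G u) {x : A}
    {C D : List A} {k : ℕ} (hC : C ∈ columns G k (below G x)) (h : ∀ r, ¬ FailsAt G r C D) :
    colProd u C * (u x * colProd u D - colProd u D * u x) = 0 := by
  obtain ⟨Y, C', rfl, hYD⟩ := exists_forall₂_of_not_failsAt h
  have hchain : (x :: Y).IsChain (fun y z => G z y) :=
    List.IsChain.left_of_append (l₁ := x :: Y) <|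
      isChain_of_mem_columns (cons_mem_columns.2 ⟨Finset.mem_singleton_self x, hC⟩)
  have hcomm := wordProd_mul_comm_of_forall₂ hu (x := x) (Y := Y.reverse) (Z := D.reverse)
    (by simpa using List.isChain_reverse.2 hchain) (List.forall₂_reverse_iff.2 hYD)
  simp only [colProd_append, mul_assoc, mul_sub]
  rw [colProd, colProd, colProd, hcomm, sub_self]

theorem sum_colProd_mul_commutator [IsTrans A G] (hu : KnuthRelations G u) {x d : A}
    {Y Z : List A} (h : List.Forall₂ (fun y z => ¬ G y z) Y Z)
    (hZ : (Z ++ [d]).IsChain (fun y z => G z y)) (hx : ∀ z ∈ (Z ++ [d]).head?, ¬ G x z)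
    (p q : ℕ) :
    ∑ C ∈ columns G p (below G d), ∑ D ∈ columns G q (below G d),
        colProd u (Y ++ C) * (u x * colProd u (Z ++ d :: D) - colProd u (Z ++ d :: D) * u x) =
      columnSum G u p (below G d) * columnSum G u q (below G d) *
        (wordProd u (Y.reverse ++ [x]) * wordProd u (d :: Z.reverse) -
          wordProd u Y.reverse * wordProd u (d :: Z.reverse) * u x) := by
  have hchain := isChain_cons_reverse hZ
  rw [mul_sub, ← mul_assoc _ _ (u x),
    ← sum_colProd_mul_colProd hu (rowPaired_reverse_concat h hZ hx) hchain,
    ← sum_colProd_mul_colProd hu (rowPaired_reverse_cons h hZ) hchain]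
  simp only [Finset.sum_mul, ← Finset.sum_sub_distrib]
  refine Finset.sum_congr rfl fun C _ => Finset.sum_congr rfl fun D _ => ?_
  simp only [colProd, List.reverse_append, List.reverse_cons, wordProd_append, wordProd_cons,
    wordProd_nil, mul_one, mul_assoc, mul_sub]

open Classical in
theorem columnSum_mul_commutator_eq_sum [IsTrans A G] (hu : KnuthRelations G u) (x : A)
    (B : Finset A) {p q M : ℕ} (hM : q ≤ M) :
    columnSum G u p (below G x) * (u x * columnSum G u q B - columnSum G u q B * u x) =
      ∑ r ∈ Finset.range M, ∑ C ∈ columns G p (below G x), ∑ D ∈ columns G q B,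
        if FirstFailsAt G r C D
          then colProd u C * (u x * colProd u D - colProd u D * u x) else 0 := by
  simp only [columnSum, Finset.sum_mul, Finset.mul_sum, ← Finset.sum_sub_distrib]
  rw [Finset.sum_comm, Finset.sum_comm (s := Finset.range M)]
  refine Finset.sum_congr rfl fun C hC => ?_
  rw [Finset.sum_comm]
  refine Finset.sum_congr rfl fun D hD => ?_
  by_cases hfail : ∃ r, FailsAt G r C D
  · rw [sum_ite_firstFailsAt ((length_of_mem_columns hD).trans_le hM) hfail]
  · rw [colProd_mul_commutator_eq_zero hu hC (not_exists.1 hfail)]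
    simp only [ite_self, Finset.sum_const_zero]

theorem columnSum_mul_commutator_symm [IsTrans A G] [Std.Trichotomous G]
    (hu : KnuthRelations G u) {x : A} {B : Finset A} (hx : ∀ d ∈ B, ¬ G x d)
    (hcl : ∀ d ∈ B, below G d ⊆ B)
    (hB : ∀ d ∈ B, ∀ p q, Commute (columnSum G u p (below G d)) (columnSum G u q (below G d)))
    (p q : ℕ) :
    columnSum G u p (below G x) *
        (u x * columnSum G u (q + 1) B - columnSum G u (q + 1) B * u x) =
      columnSum G u q (below G x) *
        (u x * columnSum G u (p + 1) B - columnSum G u (p + 1) B * u x) := by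
  rw [columnSum_mul_commutator_eq_sum hu x B (M := p + q + 1) (by omega),
    columnSum_mul_commutator_eq_sum hu x B (M := p + q + 1) (by omega)]
  refine Finset.sum_congr rfl fun r _ => sum_firstFailsAt_symm
    (fun d hd => below_subset_below_of_not_rel (hx d hd)) r (fun Y Z d _ hZ hYZ p q => ?_) p q
  have hZ' := mem_columns.1 hZ
  have hxZ : ∀ z ∈ (Z ++ [d]).head?, ¬ G x z := fun z hz => hx z (hZ'.2.2 z hz)
  have hd : d ∈ B := mem_of_mem_columns hcl hZ d (by simp)
  simp only [sum_colProd_mul_commutator hu hYZ hZ'.2.1 hxZ, (hB d hd p q).eq]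

theorem commute_columnSum [IsColumnOrder G] (hu : KnuthRelations G u) {S : Finset A}
    (hS : ∀ d ∈ S, below G d ⊆ S) (p q : ℕ) : Commute (columnSum G u p S) (columnSum G u q S) := by
  classical
  induction S using Finset.strongInduction generalizing p q with
  | H S ih =>
  obtain rfl | hne := S.eq_empty_or_nonempty
  · cases p <;> simp [columnSum_succ]
  obtain ⟨x, hx, hmax⟩ := exists_top (G := G) hne
  have hxB : ∀ d ∈ S.erase x, G d x := fun d hd =>
    hmax d (Finset.mem_of_mem_erase hd) (Finset.ne_of_mem_erase hd)
  have hBx : ∀ d ∈ S.erase x, ¬ G x d := fun d hd h =>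
    Finset.ne_of_mem_erase hd (antisymm (hxB d hd) h)
  have hB : ∀ d ∈ S.erase x, below G d ⊆ S.erase x := fun d hd w hw =>
    Finset.mem_erase.2
      ⟨fun h => hBx d hd (h ▸ mem_below.1 hw), hS d (Finset.mem_of_mem_erase hd) hw⟩
  have hBS : S.erase x ⊂ S := Finset.erase_ssubset hx
  have hsymm := columnSum_mul_commutator_symm hu hBx hB fun d hd =>
    ih _ ((hB d hd).trans_ssubset hBS) fun e he => below_subset_below_of_rel (mem_below.1 he)
  have hsplit := fun k => columnSum_succ_eq_add (G := G) (u := u) k hx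
  by_cases hxx : G x x
  · have hxS : below G x = S := (hS x hx).antisymm fun y hy => mem_below.2 <|
      (eq_or_ne y x).elim (fun h => h ▸ hxx) (hmax y hy)
    rw [hxS] at hsymm hsplit
    exact commute_of_eq_add_mul_self (a := (columnSum G u · S))
      (b := (columnSum G u · (S.erase x))) (columnSum_zero S) hsplit
      (fun p q => ih _ hBS hB (p + 1) (q + 1)) hsymm p q
  · have hxS : below G x = S.erase x := (Finset.subset_erase.2
      ⟨hS x hx, fun h => hxx (mem_below.1 h)⟩).antisymm fun y hy => mem_below.2 (hxB y hy)
    rw [hxS] at hsymm hsplit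
    refine commute_of_eq_add_mul (a := (columnSum G u · S))
      (b := (columnSum G u · (S.erase x))) (columnSum_zero S) hsplit
      (ih _ hBS hB) (fun k => ?_) hsymm p q
    simpa using wordProd_mul_columnSum hu (Y := [x]) (Z := [x]) k ⟨hxx, trivial⟩
      fun w hw => by simpa using hxB w hw

end Commutation

section Tuples

variable {α : Type*}

open Classical in
/-- The finite set of the lists whose entries are picked from the corresponding entries of a list
of finite sets. -/
noncomputable def tuples : List (Finset α) → Finset (List α)
  | [] => {[]}
  | s :: K => s.biUnion fun x => (tuples K).image (x :: ·)

theorem mem_tuples {K : List (Finset α)} {l : List α} :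
    l ∈ tuples K ↔ List.Forall₂ (· ∈ ·) l K := by
  induction K generalizing l with
  | nil => simp [tuples]
  | cons s K ih =>
    simp only [tuples, Finset.mem_biUnion, Finset.mem_image, ih, List.forall₂_cons_right_iff]
    aesop

theorem sum_tuples_cons {M : Type*} [AddCommMonoid M] (s : Finset α) (K : List (Finset α))
    (f : List α → M) :
    ∑ l ∈ tuples (s :: K), f l = ∑ x ∈ s, ∑ l ∈ tuples K, f (x :: l) := by
  classical
  rw [tuples, Finset.sum_biUnion]
  · exact Finset.sum_congr rfl fun x _ => Finset.sum_image (by simp)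
  · intro x _ y _ hxy
    simp only [Function.onFun, Finset.disjoint_left, Finset.mem_image]
    rintro _ ⟨l, _, rfl⟩ ⟨l', _, hl'⟩
    exact hxy (List.cons.inj hl').1.symm

theorem sum_tuples_append {M : Type*} [AddCommMonoid M] (K K' : List (Finset α))
    (f : List α → M) :
    ∑ l ∈ tuples (K ++ K'), f l = ∑ l ∈ tuples K, ∑ l' ∈ tuples K', f (l ++ l') := by
  induction K generalizing f with
  | nil => simp [tuples]
  | cons s K ih => simp only [List.cons_append, sum_tuples_cons, ih]

theorem prod_map_sum_eq_sum_tuples {R : Type*} [Semiring R] (K : List (Finset α)) (f : α → R) :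
    (K.map fun s => ∑ x ∈ s, f x).prod = ∑ l ∈ tuples K, (l.map f).prod := by
  induction K with
  | nil => simp [tuples]
  | cons s K ih =>
    simp only [List.map_cons, List.prod_cons, ih, sum_tuples_cons, Finset.sum_mul_sum]

end Tuples

section TableauTuples

variable {A : Type*} {G : A → A → Prop}

/-- Row `s` prevents column `j + 1` from standing to the right of column `j`. -/
def TupleFailsAt (G : A → A → Prop) (Cs : List (List A)) (s j : ℕ) : Prop :=
  FailsAt G s (Cs.getD j []) (Cs.getD (j + 1) [])

/-- A list of columns forms a tableau: each column may stand to the right of the preceding one. -/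
def IsTableauTuple (G : A → A → Prop) (Cs : List (List A)) : Prop :=
  ∀ s j, ¬ TupleFailsAt G Cs s j

/-- Row `r` is the topmost row in which the tableau condition fails, and within this row, `j` is
the rightmost column such that it fails between the columns `j` and `j + 1`. -/
structure SelectedAt (G : A → A → Prop) (r j : ℕ) (Cs : List (List A)) : Prop where
  fails : TupleFailsAt G Cs r j
  not_fails_above : ∀ s < r, ∀ i, ¬ TupleFailsAt G Cs s i
  not_fails_right : ∀ i > j, ¬ TupleFailsAt G Cs r i

theorem TupleFailsAt.succ_lt_length {Cs : List (List A)} {s j : ℕ} (h : TupleFailsAt G Cs s j) :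
    j + 1 < Cs.length := by
  by_contra! hj
  rw [TupleFailsAt, List.getD_eq_default _ _ hj] at h
  exact not_failsAt_nil_right _ _ h

theorem TupleFailsAt.exists_lt_length {Cs : List (List A)} {s j : ℕ}
    (h : TupleFailsAt G Cs s j) : ∃ C ∈ Cs, s < C.length := by
  have hs := h.lt_length
  rw [List.getD_eq_getElem _ _ h.succ_lt_length] at hs
  exact ⟨_, List.getElem_mem _, hs⟩

theorem IsTableauTuple.length_le {Cs : List (List A)} (h : IsTableauTuple G Cs) {i : ℕ}
    (hi : i + 1 < Cs.length) : Cs[i + 1].length ≤ Cs[i].length := by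
  by_contra! hlt
  refine h Cs[i].length i ⟨Cs[i + 1][Cs[i].length], ?_, ?_⟩
  · rw [List.getD_eq_getElem _ _ hi, List.getElem?_eq_getElem hlt, Option.mem_def]
  · simp [List.getElem?_eq_getElem (Nat.lt_of_succ_lt hi)]

theorem SelectedAt.unique {Cs : List (List A)} {r r' j j' : ℕ} (h : SelectedAt G r j Cs)
    (h' : SelectedAt G r' j' Cs) : r = r' ∧ j = j' := by
  obtain rfl : r = r' := le_antisymm
    (not_lt.1 fun hr => h.not_fails_above r' hr j' h'.fails)
    (not_lt.1 fun hr => h'.not_fails_above r hr j h.fails)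
  exact ⟨rfl, le_antisymm (not_lt.1 fun hj => h'.not_fails_right j hj h.fails)
    (not_lt.1 fun hj => h.not_fails_right j' hj h'.fails)⟩

theorem exists_selectedAt {Cs : List (List A)} (h : ¬ IsTableauTuple G Cs) :
    ∃ r j, SelectedAt G r j Cs := by
  classical
  simp only [IsTableauTuple, not_forall, not_not] at h
  obtain ⟨r, ⟨j, hj⟩, hr⟩ : ∃ r, (∃ j, TupleFailsAt G Cs r j) ∧
      ∀ s < r, ¬ ∃ j, TupleFailsAt G Cs s j :=
    ⟨Nat.find h, Nat.find_spec h, fun s => Nat.find_min h⟩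
  have hle : ∀ i, TupleFailsAt G Cs r i → i ≤ Cs.length := fun i hi => by
    have := hi.succ_lt_length
    omega
  exact ⟨r, Nat.findGreatest (TupleFailsAt G Cs r) Cs.length, {
    fails := Nat.findGreatest_spec (hle j hj) hj
    not_fails_above := fun s hs => not_exists.1 (hr s hs)
    not_fails_right := fun i hi hf => hi.not_ge (Nat.le_findGreatest (hle i hf) hf) }⟩

open Classical in
theorem sum_ite_selectedAt {Q : Type*} [AddCommMonoid Q] {Cs : List (List A)} {M t : ℕ}
    (hM : ∀ C ∈ Cs, C.length ≤ M) (ht : Cs.length = t) (w : Q) :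
    ∑ rj ∈ Finset.range M ×ˢ Finset.range t, (if SelectedAt G rj.1 rj.2 Cs then w else 0) =
      if IsTableauTuple G Cs then 0 else w := by
  split_ifs with h
  · exact Finset.sum_eq_zero fun rj _ => if_neg fun hs => h _ _ hs.fails
  · obtain ⟨r, j, hs⟩ := exists_selectedAt h
    have hselected : ∀ rj : ℕ × ℕ, SelectedAt G rj.1 rj.2 Cs ↔ rj = (r, j) := fun rj =>
      ⟨fun h => Prod.ext_iff.2 (h.unique hs), by rintro rfl; exact hs⟩
    obtain ⟨C, hC, hr⟩ := hs.fails.exists_lt_length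
    have hj := hs.fails.succ_lt_length
    simp only [hselected, Finset.sum_ite_eq', Finset.mem_product, Finset.mem_range]
    exact if_pos ⟨hr.trans_le (hM C hC), by omega⟩

theorem tupleFailsAt_length (P T : List (List A)) (C D : List A) (s : ℕ) :
    TupleFailsAt G (P ++ C :: D :: T) s P.length ↔ FailsAt G s C D := by
  simp [TupleFailsAt, List.getD_eq_getElem?_getD]

theorem getElem?_getD_take (P T : List (List A)) (C D : List A) {r s j : ℕ}
    (h : s < r ∨ s = r ∧ P.length < j) :
    ((P ++ C :: D :: T).getD j [])[s]? =
      ((P ++ C.take r :: D.take (r + 1) :: T).getD j [])[s]? := by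
  obtain hj | hj := lt_or_ge j P.length
  · rw [List.getD_append _ _ _ _ hj, List.getD_append _ _ _ _ hj]
  · obtain ⟨k, rfl⟩ := Nat.exists_eq_add_of_le hj
    simp only [List.getD_append_right _ _ _ _ hj, Nat.add_sub_cancel_left]
    obtain _ | _ | k := k
    · exact (List.getElem?_take_of_lt (by omega)).symm
    · exact (List.getElem?_take_of_lt (by omega)).symm
    · rfl

theorem tupleFailsAt_take (P T : List (List A)) (C D : List A) {r s j : ℕ}
    (h : s < r ∨ s = r ∧ P.length < j) :
    TupleFailsAt G (P ++ C :: D :: T) s j ↔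
      TupleFailsAt G (P ++ C.take r :: D.take (r + 1) :: T) s j := by
  simp only [TupleFailsAt, FailsAt, getElem?_getD_take P T C D h,
    getElem?_getD_take P T C D (j := j + 1) (h.imp_right fun h => ⟨h.1, by omega⟩)]

/-- The position of the selected failure depends only on the heads of the two columns involved,
which the exchange of tails leaves in place. -/
theorem selectedAt_iff_take (P T : List (List A)) (C D : List A) (r : ℕ) :
    SelectedAt G r P.length (P ++ C :: D :: T) ↔ FirstFailsAt G r C D ∧
      SelectedAt G r P.length (P ++ C.take r :: D.take (r + 1) :: T) := by
  have hfails : FailsAt G r C D → FailsAt G r (C.take r) (D.take (r + 1)) := fun ⟨d, hd, _⟩ =>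
    ⟨d, by rwa [List.getElem?_take_of_lt r.lt_succ_self], by simp⟩
  have habove : ∀ s < r, ∀ i, TupleFailsAt G (P ++ C :: D :: T) s i ↔ _ := fun s hs i =>
    tupleFailsAt_take P T C D (.inl hs)
  have hright : ∀ i > P.length, TupleFailsAt G (P ++ C :: D :: T) r i ↔ _ := fun i hi =>
    tupleFailsAt_take P T C D (.inr ⟨rfl, hi⟩)
  constructor
  · intro h
    have hCD := (tupleFailsAt_length P T C D r).1 h.fails
    exact ⟨⟨hCD, fun s hs hf => h.not_fails_above s hs _ ((tupleFailsAt_length P T C D s).2 hf)⟩,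
      (tupleFailsAt_length P T _ _ r).2 (hfails hCD),
      fun s hs i hf => h.not_fails_above s hs i ((habove s hs i).2 hf),
      fun i hi hf => h.not_fails_right i hi ((hright i hi).2 hf)⟩
  · rintro ⟨hCD, h⟩
    exact ⟨(tupleFailsAt_length P T C D r).2 hCD.1,
      fun s hs i hf => h.not_fails_above s hs i ((habove s hs i).1 hf),
      fun i hi hf => h.not_fails_right i hi ((hright i hi).1 hf)⟩

variable {Q : Type*} [Monoid Q] {u : A → Q}

/-- The product of the variables along the concatenated reading words of a list of columns. -/
def tupleProd (u : A → Q) (Cs : List (List A)) : Q := (Cs.map (colProd u)).prod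

theorem tupleProd_append_cons_cons (P T : List (List A)) (C D : List A) :
    tupleProd u (P ++ C :: D :: T) =
      tupleProd u P * (colProd u C * colProd u D) * tupleProd u T := by
  simp [tupleProd, mul_assoc]

end TableauTuples

section Exchange

variable {A Q : Type*} [Fintype A] {G : A → A → Prop} {u : A → Q}

/-- The finite set of all columns of length `k`, which is empty for `k < 0`. -/
noncomputable def columnsInt (G : A → A → Prop) : ℤ → Finset (List A)
  | Int.ofNat k => columns G k Finset.univ
  | Int.negSucc _ => ∅

theorem columnsInt_natCast (k : ℕ) : columnsInt G k = columns G k Finset.univ := rfl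

theorem columnsInt_of_neg {k : ℤ} (hk : k < 0) : columnsInt G k = ∅ := by
  obtain ⟨k, rfl⟩ := Int.eq_negSucc_of_lt_zero hk
  rfl

theorem mem_columnsInt {k : ℤ} {C : List A} :
    C ∈ columnsInt G k ↔ (C.length : ℤ) = k ∧ C.IsChain (fun x y => G y x) := by
  obtain hk | hk := lt_or_ge k 0
  · rw [columnsInt_of_neg hk]
    refine iff_of_false (Finset.notMem_empty C) ?_
    omega
  · lift k to ℕ using hk
    simp [columnsInt_natCast, mem_columns]

/-- The finite set of the lists of columns whose lengths are prescribed by a list of integers. -/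
noncomputable def columnTuples (G : A → A → Prop) (L : List ℤ) : Finset (List (List A)) :=
  tuples (L.map (columnsInt G))

theorem mem_columnTuples {L : List ℤ} {Cs : List (List A)} :
    Cs ∈ columnTuples G L ↔ Cs.map (fun C => (C.length : ℤ)) = L ∧
      ∀ C ∈ Cs, C.IsChain (fun x y => G y x) := by
  rw [columnTuples, mem_tuples]
  induction Cs generalizing L with
  | nil => simp [eq_comm]
  | cons C Cs ih =>
    cases L with
    | nil => simp
    | cons k L =>
      simp only [List.map_cons, List.forall₂_cons, mem_columnsInt, ih, List.cons.injEq,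
        List.forall_mem_cons]
      exact and_and_and_comm

open Classical in
theorem sum_columnsInt_firstFailsAt_symm [IsTrans A G] [Std.Trichotomous G] [AddCommMonoid Q]
    {F : List A → List A → Q} (r : ℕ)
    (hF : ∀ Y Z d, Y.length = r → Z.length = r → List.Forall₂ (fun y z => ¬ G y z) Y Z →
      (Z ++ [d]).IsChain (fun y z => G z y) → ∀ p q,
      ∑ C ∈ columns G p (below G d), ∑ D ∈ columns G q (below G d), F (Y ++ C) (Z ++ d :: D) =
      ∑ C ∈ columns G q (below G d), ∑ D ∈ columns G p (below G d), F (Y ++ C) (Z ++ d :: D))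
    (a b : ℤ) :
    ∑ C ∈ columnsInt G a, ∑ D ∈ columnsInt G b, (if FirstFailsAt G r C D then F C D else 0) =
      ∑ C ∈ columnsInt G (b - 1), ∑ D ∈ columnsInt G (a + 1),
        if FirstFailsAt G r C D then F C D else 0 := by
  have hnonpos : ∀ C : List A, ∀ k ≤ 0, ∀ D ∈ columnsInt G k, ¬ FirstFailsAt G r C D :=
    fun C k hk D hD h => by
      have hlen := (mem_columnsInt.1 hD).1
      have hlt := h.1.lt_length
      omega
  obtain ha | ha := lt_or_ge a 0
  · rw [columnsInt_of_neg ha, Finset.sum_empty]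
    exact (Finset.sum_eq_zero fun C _ => Finset.sum_eq_zero fun D hD =>
      if_neg (hnonpos C _ (by omega) D hD)).symm
  obtain hb | hb := lt_or_ge 0 b
  · lift a to ℕ using ha
    obtain ⟨b, rfl⟩ : ∃ k : ℕ, b = (k : ℤ) + 1 := ⟨(b - 1).toNat, by omega⟩
    rw [add_sub_cancel_right]
    refine sum_firstFailsAt_symm (fun _ _ => Finset.subset_univ _) r
      (fun Y Z d hY hZ hYZ p q => ?_) a b
    have hYr := length_of_mem_columns hY
    exact hF Y Z d hYr (hYZ.length_eq.symm.trans hYr) hYZ (isChain_of_mem_columns hZ) p q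
  · rw [columnsInt_of_neg (k := b - 1) (by omega), Finset.sum_empty]
    exact Finset.sum_eq_zero fun C _ => Finset.sum_eq_zero fun D hD =>
      if_neg (hnonpos C _ hb D hD)

open Classical in
theorem sum_columnTuples_selectedAt [AddCommMonoid Q] (r : ℕ) (L L' : List ℤ) (a b : ℤ)
    (f : List (List A) → Q) :
    ∑ Cs ∈ columnTuples G (L ++ a :: b :: L'), (if SelectedAt G r L.length Cs then f Cs else 0) =
      ∑ P ∈ columnTuples G L, ∑ T ∈ columnTuples G L',
        ∑ C ∈ columnsInt G a, ∑ D ∈ columnsInt G b, if FirstFailsAt G r C D then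
          (if SelectedAt G r P.length (P ++ C.take r :: D.take (r + 1) :: T)
            then f (P ++ C :: D :: T) else 0) else 0 := by
  simp only [columnTuples, List.map_append, List.map_cons, sum_tuples_append, sum_tuples_cons]
  refine Finset.sum_congr rfl fun P hP => ?_
  have hPL : L.length = P.length := by
    simpa using congrArg List.length (mem_columnTuples.1 hP).1.symm
  symm
  rw [Finset.sum_comm]
  refine Finset.sum_congr rfl fun C _ => ?_
  rw [Finset.sum_comm]
  refine Finset.sum_congr rfl fun D _ => Finset.sum_congr rfl fun T _ => ?_
  rw [hPL]
  exact (ite_and ..).symm.trans (if_congr (selectedAt_iff_take P T C D r).symm rfl rfl)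

open Classical in
theorem sum_selectedAt_exchange [IsColumnOrder G] [Ring Q] (hu : KnuthRelations G u) (r : ℕ)
    (L L' : List ℤ) (a b : ℤ) :
    ∑ Cs ∈ columnTuples G (L ++ a :: b :: L'),
        (if SelectedAt G r L.length Cs then tupleProd u Cs else 0) =
      ∑ Cs ∈ columnTuples G (L ++ (b - 1) :: (a + 1) :: L'),
        if SelectedAt G r L.length Cs then tupleProd u Cs else 0 := by
  rw [sum_columnTuples_selectedAt, sum_columnTuples_selectedAt]
  refine Finset.sum_congr rfl fun P _ => Finset.sum_congr rfl fun T _ =>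
    sum_columnsInt_firstFailsAt_symm r (fun Y Z d hY hZ hYZ hchain p q => ?_) a b
  subst hY
  have hcomm := commute_columnSum hu (S := below G d)
    (fun e he => below_subset_below_of_rel (mem_below.1 he)) p q
  have htake : ∀ D : List A, (Z ++ d :: D).take (Y.length + 1) = Z ++ [d] := fun D => by
    simp [← hZ, List.take_append]
  simp only [List.take_left, htake]
  split_ifs
  · have hrow := sum_colProd_mul_colProd hu (rowPaired_reverse_cons hYZ hchain)
      (isChain_cons_reverse hchain)
    have htails : ∀ C D, colProd u (Y ++ C) * colProd u (Z ++ d :: D) =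
        colProd u C * wordProd u Y.reverse * (colProd u D * wordProd u (d :: Z.reverse)) :=
      fun C D => by simp only [colProd, List.reverse_append, List.reverse_cons, wordProd_append,
        wordProd_cons, wordProd_nil, mul_one, mul_assoc]
    simp only [tupleProd_append_cons_cons, htails, ← Finset.mul_sum, ← Finset.sum_mul] at hrow ⊢
    rw [hrow, hcomm.eq, hrow]
  · simp

end Exchange

section SignReversal

theorem ofFn_eq_take_append_drop {α : Type*} {t i : ℕ} (hi : i + 1 < t) (f : Fin t → α) :
    List.ofFn f = (List.ofFn f).take i ++
      f ⟨i, Nat.lt_of_succ_lt hi⟩ :: f ⟨i + 1, hi⟩ :: (List.ofFn f).drop (i + 2) := by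
  conv_lhs => rw [← List.take_append_drop i (List.ofFn f)]
  rw [List.drop_eq_getElem_cons (by rw [List.length_ofFn]; omega),
    List.drop_eq_getElem_cons (by rwa [List.length_ofFn]), List.getElem_ofFn, List.getElem_ofFn]

theorem exists_ofFn_eq_append {α : Type*} {t i : ℕ} (hi : i + 1 < t) {f g : Fin t → α}
    (h : ∀ j : Fin t, (j : ℕ) ≠ i → (j : ℕ) ≠ i + 1 → f j = g j) :
    ∃ L L' : List α, L.length = i ∧
      List.ofFn f = L ++ f ⟨i, Nat.lt_of_succ_lt hi⟩ :: f ⟨i + 1, hi⟩ :: L' ∧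
      List.ofFn g = L ++ g ⟨i, Nat.lt_of_succ_lt hi⟩ :: g ⟨i + 1, hi⟩ :: L' := by
  have htake : (List.ofFn f).take i = (List.ofFn g).take i :=
    List.ext_getElem (by simp) fun n hn _ => by
      simp only [List.length_take, List.length_ofFn, lt_min_iff] at hn
      simpa using h ⟨n, hn.2⟩ hn.1.ne (by simp only; omega)
  have hdrop : (List.ofFn f).drop (i + 2) = (List.ofFn g).drop (i + 2) :=
    List.ext_getElem (by simp) fun n _ _ => by
      simpa using h _ (by simp only; omega) (by simp only; omega)
  refine ⟨(List.ofFn f).take i, (List.ofFn f).drop (i + 2), ?_, ofFn_eq_take_append_drop hi f, ?_⟩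
  · rw [List.length_take, List.length_ofFn]
    omega
  · rw [htake, hdrop]
    exact ofFn_eq_take_append_drop hi g

theorem exists_lt_of_ne_one {t : ℕ} {σ : Equiv.Perm (Fin t)} (hσ : σ ≠ 1) :
    ∃ i, ∃ hi : i + 1 < t, σ ⟨i + 1, hi⟩ < σ ⟨i, Nat.lt_of_succ_lt hi⟩ := by
  by_contra! h
  obtain _ | t := t
  · exact hσ (Subsingleton.elim _ _)
  have hσ_mono : StrictMono σ := Fin.strictMono_iff_lt_succ.2 fun i =>
    (h i (by omega)).lt_of_ne fun he => by simpa [Fin.ext_iff] using σ.injective he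
  exact hσ (Equiv.ext (congrFun ((hσ_mono.range_inj strictMono_id).1 (by simp))))

variable {A Q : Type*} [Fintype A] {G : A → A → Prop} {t : ℕ}

theorem length_of_mem_columnTuples {f : Fin t → ℤ} {Cs : List (List A)}
    (h : Cs ∈ columnTuples G (List.ofFn f)) : Cs.length = t := by
  simpa using congrArg List.length (mem_columnTuples.1 h).1

theorem length_getElem_of_mem_columnTuples {f : Fin t → ℤ} {Cs : List (List A)}
    (h : Cs ∈ columnTuples G (List.ofFn f)) {j : ℕ} (hj : j < t)
    (hjC : j < Cs.length := (length_of_mem_columnTuples h).symm ▸ hj) :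
    (Cs[j].length : ℤ) = f ⟨j, hj⟩ := by
  have := List.getElem_of_eq (mem_columnTuples.1 h).1 (by simpa using hjC)
  simpa using this

theorem length_le_of_mem_columnTuples {γ : Fin t → ℤ} {σ : Equiv.Perm (Fin t)}
    {Cs : List (List A)} (h : Cs ∈ columnTuples G (List.ofFn fun j => γ (σ j) + (j : ℕ))) :
    ∀ C ∈ Cs, C.length ≤ ∑ j, (γ j).natAbs + t := by
  intro C hC
  obtain ⟨j, hj, rfl⟩ := List.getElem_of_mem hC
  have hjt := length_of_mem_columnTuples h ▸ hj
  have hlen := length_getElem_of_mem_columnTuples h hjt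
  have hγ := Finset.single_le_sum (f := fun j => (γ j).natAbs) (fun _ _ => Nat.zero_le _)
    (Finset.mem_univ (σ ⟨j, hjt⟩))
  simp only at hlen hγ
  omega

theorem not_isTableauTuple_of_ne_one {γ : Fin t → ℤ} (hγ : StrictAnti γ)
    {σ : Equiv.Perm (Fin t)} (hσ : σ ≠ 1) {Cs : List (List A)}
    (hCs : Cs ∈ columnTuples G (List.ofFn fun j => γ (σ j) + (j : ℕ))) :
    ¬ IsTableauTuple G Cs := by
  intro hT
  obtain ⟨i, hi, hlt⟩ := exists_lt_of_ne_one hσ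
  have hle := hT.length_le (i := i) (by rwa [length_of_mem_columnTuples hCs])
  have hlen := length_getElem_of_mem_columnTuples hCs (Nat.lt_of_succ_lt hi)
  have hlen' := length_getElem_of_mem_columnTuples hCs hi
  have hγi := hγ hlt
  simp only [Nat.cast_succ] at hlen hlen'
  omega

variable {u : A → Q}

theorem prod_map_sum_columnsInt [Semiring Q] (L : List ℤ) :
    (L.map fun k => ∑ C ∈ columnsInt G k, colProd u C).prod =
      ∑ Cs ∈ columnTuples G L, tupleProd u Cs := by
  have h := prod_map_sum_eq_sum_tuples (L.map (columnsInt G)) (colProd u)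
  rwa [List.map_map] at h

open Classical in
theorem sum_tupleProd_eq_add [Semiring Q] {L : List ℤ} {M t : ℕ}
    (hM : ∀ Cs ∈ columnTuples G L, ∀ C ∈ Cs, C.length ≤ M) (ht : L.length = t) :
    ∑ Cs ∈ columnTuples G L, tupleProd u Cs =
      (∑ Cs ∈ columnTuples G L with IsTableauTuple G Cs, tupleProd u Cs) +
      ∑ rj ∈ Finset.range M ×ˢ Finset.range t, ∑ Cs ∈ columnTuples G L,
        if SelectedAt G rj.1 rj.2 Cs then tupleProd u Cs else 0 := by
  rw [Finset.sum_comm (t := columnTuples G L), Finset.sum_filter, ← Finset.sum_add_distrib]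
  refine Finset.sum_congr rfl fun Cs hCs => ?_
  have hlen : Cs.length = t := by
    simpa [ht] using congrArg List.length (mem_columnTuples.1 hCs).1
  rw [sum_ite_selectedAt (hM Cs hCs) hlen]
  split_ifs <;> simp

variable [Ring Q] [IsColumnOrder G]

open Classical in
/-- Composing `σ` with the transposition of `i` and `i + 1` changes the sign and replaces the column
lengths `a, b` at these positions by `b - 1, a + 1`. -/
theorem sum_sign_selectedAt (hu : KnuthRelations G u) (γ : Fin t → ℤ) (r i : ℕ) :
    ∑ σ : Equiv.Perm (Fin t), ((Equiv.Perm.sign σ : ℤˣ) : ℤ) •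
      (∑ Cs ∈ columnTuples G (List.ofFn fun j => γ (σ j) + (j : ℕ)),
        if SelectedAt G r i Cs then tupleProd u Cs else 0) = 0 := by
  obtain hi | hi := le_or_gt t (i + 1)
  · refine Finset.sum_eq_zero fun σ _ => ?_
    rw [Finset.sum_eq_zero, smul_zero]
    refine fun Cs hCs => if_neg fun hs => ?_
    have := hs.fails.succ_lt_length
    rw [length_of_mem_columnTuples hCs] at this
    omega
  set i₀ : Fin t := ⟨i, Nat.lt_of_succ_lt hi⟩ with hi₀
  set i₁ : Fin t := ⟨i + 1, hi⟩ with hi₁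
  have hne : i₀ ≠ i₁ := by simp [hi₀, hi₁]
  refine Finset.sum_involution (fun σ _ => σ * Equiv.swap i₀ i₁) (fun σ _ => ?_)
    (fun σ _ _ h => hne (Equiv.swap_eq_one_iff.1 (mul_eq_left.1 h)))
    (fun σ _ => Finset.mem_univ _) (fun σ _ => by simp [mul_assoc])
  obtain ⟨L, L', rfl, hσ, hσ'⟩ := exists_ofFn_eq_append hi (f := fun j => γ (σ j) + (j : ℕ))
    (g := fun j => γ ((σ * Equiv.swap i₀ i₁) j) + (j : ℕ)) fun j hj₀ hj₁ => by
      rw [Equiv.Perm.mul_apply, Equiv.swap_apply_of_ne_of_ne (Fin.ne_of_val_ne hj₀)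
        (Fin.ne_of_val_ne hj₁)]
  have hb : γ (σ i₁) + ((L.length + 1 : ℕ) : ℤ) - 1 = γ (σ i₁) + (L.length : ℤ) := by
    push_cast
    ring
  have ha : γ (σ i₀) + (L.length : ℤ) + 1 = γ (σ i₀) + ((L.length + 1 : ℕ) : ℤ) := by
    push_cast
    ring
  rw [hσ, hσ', sum_selectedAt_exchange hu, ← hi₀, ← hi₁, hb, ha]
  simp only [Equiv.Perm.mul_apply, Equiv.swap_apply_left, Equiv.swap_apply_right,
    Equiv.Perm.sign_mul, Equiv.Perm.sign_swap hne, mul_neg, mul_one, Units.val_neg, neg_smul]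
  exact add_neg_cancel _

open Classical in
theorem sum_sign_prod_eq_sum_isTableauTuple (hu : KnuthRelations G u) {γ : Fin t → ℤ}
    (hγ : StrictAnti γ) :
    ∑ σ : Equiv.Perm (Fin t), ((Equiv.Perm.sign σ : ℤˣ) : ℤ) •
      (List.ofFn fun j => ∑ C ∈ columnsInt G (γ (σ j) + (j : ℕ)), colProd u C).prod =
    ∑ Cs ∈ columnTuples G (List.ofFn fun j => γ j + (j : ℕ)) with IsTableauTuple G Cs,
      tupleProd u Cs := by
  have hsplit := fun σ : Equiv.Perm (Fin t) =>
    sum_tupleProd_eq_add (u := u) (fun Cs => length_le_of_mem_columnTuples (G := G) (Cs := Cs))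
      (List.length_ofFn (f := fun j => γ (σ j) + (j : ℕ)))
  have hprod : ∀ σ : Equiv.Perm (Fin t),
      (List.ofFn fun j => ∑ C ∈ columnsInt G (γ (σ j) + (j : ℕ)), colProd u C).prod =
        ∑ Cs ∈ columnTuples G (List.ofFn fun j => γ (σ j) + (j : ℕ)), tupleProd u Cs := fun σ => by
    rw [← prod_map_sum_columnsInt, List.map_ofFn]
    rfl
  have hcancel : ∑ σ : Equiv.Perm (Fin t), ((Equiv.Perm.sign σ : ℤˣ) : ℤ) •
      ∑ rj ∈ Finset.range (∑ j, (γ j).natAbs + t) ×ˢ Finset.range t,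
        ∑ Cs ∈ columnTuples G (List.ofFn fun j => γ (σ j) + (j : ℕ)),
          (if SelectedAt G rj.1 rj.2 Cs then tupleProd u Cs else 0) = 0 := by
    simp only [Finset.smul_sum (N := Q) (s := _ ×ˢ _)]
    rw [Finset.sum_comm]
    exact Finset.sum_eq_zero fun rj _ => sum_sign_selectedAt hu γ rj.1 rj.2
  simp only [hprod, hsplit, smul_add, Finset.sum_add_distrib]
  rw [hcancel, add_zero, Finset.sum_eq_single 1 (fun σ _ hσ => ?_) (by simp)]
  · simp
  · rw [Finset.filter_false_of_mem fun Cs hCs => not_isTableauTuple_of_ne_one hγ hσ hCs,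
      Finset.sum_empty, smul_zero]

end SignReversal

section Fillings

variable {A : Type*} {G : A → A → Prop} {ν : YoungDiagram}

/-- The list of columns of a filling of a Young diagram, each listed from top to bottom. -/
def columnList (T : ν.cells → A) : List (List A) :=
  List.ofFn fun j : Fin (ν.rowLen 0) => List.ofFn fun i : Fin (ν.colLen j) =>
    T ⟨((i : ℕ), (j : ℕ)), YoungDiagram.mem_iff_lt_colLen.2 i.isLt⟩

theorem lt_rowLen_zero {i j : ℕ} (h : (i, j) ∈ ν.cells) : j < ν.rowLen 0 :=
  YoungDiagram.mem_iff_lt_rowLen.1 (ν.up_left_mem i.zero_le le_rfl h)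

open Classical in
theorem columnList_getD_getElem? (T : ν.cells → A) (i j : ℕ) :
    ((columnList T).getD j [])[i]? =
      if h : (i, j) ∈ ν.cells then some (T ⟨(i, j), h⟩) else none := by
  split_ifs with h
  · have hi : i < ν.colLen j := YoungDiagram.mem_iff_lt_colLen.1 h
    simp [columnList, List.getD_eq_getElem?_getD, lt_rowLen_zero h, hi]
  · have hi : ν.colLen j ≤ i := not_lt.1 fun hi => h (YoungDiagram.mem_iff_lt_colLen.2 hi)
    by_cases hj : j < ν.rowLen 0 <;> simp [columnList, List.getD_eq_getElem?_getD, hj, hi]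

theorem columnList_injective : Function.Injective (columnList (A := A) (ν := ν)) := by
  classical
  intro T T' h
  funext ⟨⟨i, j⟩, hc⟩
  have hentry := columnList_getD_getElem? T i j
  rw [h, columnList_getD_getElem?, dif_pos hc, dif_pos hc] at hentry
  exact (Option.some.inj hentry).symm

theorem exists_columnList_eq {Cs : List (List A)}
    (hCs : Cs.map List.length = List.ofFn fun j : Fin (ν.rowLen 0) => ν.colLen j) :
    ∃ T : ν.cells → A, columnList T = Cs := by
  have hlen : Cs.length = ν.rowLen 0 := by simpa using congrArg List.length hCs
  have hlen' : ∀ j (hj : j < Cs.length), Cs[j].length = ν.colLen j := fun j hj => by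
    have h := List.getElem_of_eq hCs (i := j) (by rwa [List.length_map])
    rwa [List.getElem_map, List.getElem_ofFn] at h
  have hj : ∀ c : ν.cells, c.1.2 < Cs.length := fun c => hlen ▸ lt_rowLen_zero c.2
  refine ⟨fun c => (Cs[c.1.2]'(hj c))[c.1.1]'(hlen' _ (hj c) ▸
    YoungDiagram.mem_iff_lt_colLen.1 c.2), ?_⟩
  refine List.ext_getElem (by simp [columnList, hlen]) fun j _ hj => ?_
  exact List.ext_getElem (by simp [columnList, hlen']) fun i _ hi => by simp [columnList]

theorem tupleFailsAt_columnList (T : ν.cells → A) (i j : ℕ) :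
    TupleFailsAt G (columnList T) i j ↔ ∃ h : (i, j + 1) ∈ ν.cells,
      G (T ⟨(i, j), ν.up_left_mem le_rfl j.le_succ h⟩) (T ⟨(i, j + 1), h⟩) := by
  classical
  simp only [TupleFailsAt, FailsAt, columnList_getD_getElem?]
  by_cases h : (i, j + 1) ∈ ν.cells
  · have h' : (i, j) ∈ ν.cells := ν.up_left_mem le_rfl j.le_succ h
    simp only [dif_pos h, dif_pos h', Option.mem_some_iff, exists_eq_left', forall_eq',
      exists_prop_of_true h]
  · simp [h]

theorem isTableauTuple_columnList [IsTrans A G] [Std.Trichotomous G] (T : ν.cells → A) :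
    IsTableauTuple G (columnList T) ↔
      ∀ c d : ν.cells, c.1.1 = d.1.1 → c.1.2 < d.1.2 → ¬ G (T c) (T d) := by
  simp only [IsTableauTuple, tupleFailsAt_columnList, not_exists]
  refine ⟨fun h => ?_, fun h i j hj => h _ _ rfl j.lt_succ_self⟩
  have hrow : ∀ i j k, j < k → ∀ (hj : (i, j) ∈ ν.cells) (hk : (i, k) ∈ ν.cells),
      ¬ G (T ⟨(i, j), hj⟩) (T ⟨(i, k), hk⟩) := fun i j k hjk => by
    induction k, hjk using Nat.le_induction with
    | base => exact fun _ hk => h i j hk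
    | succ k _ ih =>
      intro hj hk hG
      have hik : (i, k) ∈ ν.cells := ν.up_left_mem le_rfl k.le_succ hk
      exact ih hj hik (rel_of_not_rel_of_rel (h i k hk) hG)
  rintro ⟨⟨i, j⟩, hc⟩ ⟨⟨_, k⟩, hd⟩ rfl hjk
  exact hrow i j k hjk hc hd

theorem columnList_mem_columnTuples [Fintype A] [IsTrans A G] (T : ν.cells → A) :
    columnList T ∈ columnTuples G (List.ofFn fun j : Fin (ν.rowLen 0) => (ν.colLen j : ℤ)) ↔
      ∀ c d : ν.cells, c.1.2 = d.1.2 → c.1.1 < d.1.1 → G (T d) (T c) := by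
  have : IsTrans A fun x y => G y x := ⟨fun _ _ _ h h' => _root_.trans h' h⟩
  have hlen : (columnList T).map (fun C => (C.length : ℤ)) =
      List.ofFn fun j : Fin (ν.rowLen 0) => (ν.colLen j : ℤ) := by
    simp [columnList, Function.comp_def]
  rw [mem_columnTuples, and_iff_right hlen]
  simp only [columnList, List.forall_mem_ofFn_iff, List.isChain_iff_pairwise, List.pairwise_ofFn]
  refine ⟨fun h => ?_, fun h j i k hik => h _ _ rfl hik⟩
  rintro ⟨⟨i, j⟩, hc⟩ ⟨⟨k, _⟩, hd⟩ rfl hik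
  exact @h ⟨j, lt_rowLen_zero hc⟩ ⟨i, YoungDiagram.mem_iff_lt_colLen.1 hc⟩
    ⟨k, YoungDiagram.mem_iff_lt_colLen.1 hd⟩ hik

open Classical in
theorem sum_columnTuples_isTableauTuple [Fintype A] [IsTrans A G] [Std.Trichotomous G]
    {Q : Type*} [AddCommMonoid Q] (f : List (List A) → Q) :
    ∑ Cs ∈ columnTuples G (List.ofFn fun j : Fin (ν.rowLen 0) => (ν.colLen j : ℤ))
        with IsTableauTuple G Cs, f Cs =
      ∑ T : ν.cells → A with
          (∀ c d : ν.cells, c.1.2 = d.1.2 → c.1.1 < d.1.1 → G (T d) (T c)) ∧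
          (∀ c d : ν.cells, c.1.1 = d.1.1 → c.1.2 < d.1.2 → ¬ G (T c) (T d)),
        f (columnList T) := by
  symm
  refine Finset.sum_nbij columnList (fun T hT => ?_) columnList_injective.injOn (fun Cs hCs => ?_)
    fun T _ => rfl
  · rw [Finset.mem_filter, columnList_mem_columnTuples, isTableauTuple_columnList]
    exact (Finset.mem_filter.1 hT).2
  · rw [Finset.mem_coe, Finset.mem_filter] at hCs
    obtain ⟨T, rfl⟩ : ∃ T : ν.cells → A, columnList T = Cs := by
      refine exists_columnList_eq (Nat.cast_injective (R := ℤ).list_map ?_)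
      simpa [Function.comp_def] using (mem_columnTuples.1 hCs.1).1
    rw [columnList_mem_columnTuples, isTableauTuple_columnList] at hCs
    exact ⟨T, by simpa using hCs, rfl⟩

end Fillings

section Plactic

variable {N : ℕ} {lt : Letter N → Letter N → Prop}

theorem IsShuffleOrder.isStrictTotalOrder (hlt : IsShuffleOrder lt) :
    IsStrictTotalOrder (Letter N) lt where
  irrefl := hlt.irrefl
  trans := hlt.trans
  trichotomous x y hxy hyx := ((hlt.total x y).resolve_left hxy).resolve_right hyx

/-- The image of the variable `u_x` in the colored plactic algebra. -/
noncomputable def placticVar (lt : Letter N → Letter N → Prop) (x : Letter N) :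
    PlacticAlgebra lt :=
  toPlactic lt (FreeAlgebra.ι ℤ x)

theorem toPlactic_monomial (w : ColoredWord N) :
    toPlactic lt (monomial w) = wordProd (placticVar lt) w := by
  rw [monomial, map_list_prod, List.map_map]
  rfl

theorem wordProd_placticVar_eq {v w : ColoredWord N}
    (h : PlacticRel lt (monomial v) (monomial w)) :
    wordProd (placticVar lt) v = wordProd (placticVar lt) w := by
  rw [← toPlactic_monomial, ← toPlactic_monomial]
  exact RingQuot.mkAlgHom_rel ℤ h

theorem elementary_eq_sum (k : ℤ) :
    elementary lt k = ∑ C ∈ columnsInt (ColGT lt) k, monomial C.reverse := by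
  classical
  obtain k | k := k
  · refine Finset.sum_nbij (fun z => (List.ofFn z).reverse) (fun z hz => ?_) (fun z _ z' _ h => ?_)
      (fun C hC => ?_) fun z _ => by rw [List.reverse_reverse]
    · simpa [mem_columnsInt, List.isChain_reverse] using hz
    · exact List.ofFn_injective (List.reverse_injective h)
    · obtain ⟨hlen, hC⟩ := mem_columnsInt.1 hC
      obtain ⟨z, hz⟩ : ∃ z : Fin k → Letter N, List.ofFn z = C.reverse := by
        have hk : C.reverse.length = k := by simpa using hlen
        exact ⟨fun i => C.reverse[i], List.ext_getElem (by simpa using hk.symm) (by simp)⟩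
      exact ⟨z, by simpa [hz, List.isChain_reverse] using hC, by simp [hz]⟩
  · rfl

theorem toPlactic_elementary (k : ℤ) :
    toPlactic lt (elementary lt k) =
      ∑ C ∈ columnsInt (ColGT lt) k, colProd (placticVar lt) C := by
  simp only [elementary_eq_sum, map_sum, toPlactic_monomial]
  rfl

theorem toPlactic_columnReading {ν : YoungDiagram} (T : ν.cells → Letter N) :
    toPlactic lt (monomial (columnReading T)) = tupleProd (placticVar lt) (columnList T) := by
  have hrev : ∀ {k : ℕ} (z : Fin k → Letter N),
      List.ofFn (fun i => z i.rev) = (List.ofFn z).reverse := fun z =>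
    List.ext_getElem (by simp) fun n _ _ => by simp [Fin.rev, Nat.sub_sub, Nat.add_comm 1]
  rw [toPlactic_monomial, wordProd, columnReading, List.map_flatten, List.prod_flatten,
    tupleProd, columnList, List.map_ofFn, List.map_ofFn, List.map_ofFn]
  congr 2
  funext j
  simp only [Function.comp_apply, colProd, ← hrev]
  rfl

variable [IsStrictTotalOrder (Letter N) lt]

theorem not_colGT_iff {x y : Letter N} :
    ¬ ColGT lt x y ↔ lt x y ∨ x = y ∧ x.isLeft = true := by
  constructor
  · intro h
    obtain hxy | rfl | hyx := trichotomous_of lt x y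
    · exact .inl hxy
    · exact .inr ⟨rfl, by simpa using fun hr => h (.inr ⟨rfl, hr⟩)⟩
    · exact absurd (.inl hyx) h
  · rintro (hxy | ⟨rfl, hx⟩) (hyx | ⟨hyx, hr⟩)
    · exact asymm hxy hyx
    · exact irrefl_of lt y (hyx ▸ hxy)
    · exact irrefl_of lt x hyx
    · exact absurd hr (by simpa using hx)

instance isColumnOrder_colGT : IsColumnOrder (ColGT lt) where
  trans := by
    rintro x y z (hyx | ⟨rfl, hx⟩) (hzy | ⟨rfl, -⟩)
    · exact .inl (_root_.trans hzy hyx)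
    · exact .inl hyx
    · exact .inl hzy
    · exact .inr ⟨rfl, hx⟩
  antisymm := by
    rintro x y (hyx | ⟨heq, -⟩) (hxy | ⟨heq', -⟩)
    · exact (asymm hyx hxy).elim
    · exact heq'.symm
    all_goals exact heq
  trichotomous x y hxy hyx := by
    obtain h | h | h := trichotomous_of lt x y
    · exact absurd (.inl h) hyx
    · exact h
    · exact absurd (.inl h) hxy

theorem knuthRelations_placticVar : KnuthRelations (ColGT lt) (placticVar lt) where
  swap_left {x y z} hxy hzy := by
    obtain hxy | ⟨rfl, hx⟩ := not_colGT_iff.1 hxy <;> obtain hyz | ⟨rfl, hz⟩ := hzy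
    · simpa [mul_assoc] using wordProd_placticVar_eq (.xzy_zxy _ _ _ hxy hyz)
    · obtain ⟨b, rfl⟩ := Sum.isRight_iff.1 hz
      simpa [mul_assoc] using wordProd_placticVar_eq (.barred_xyy _ _ hxy)
    · obtain ⟨b, rfl⟩ := Sum.isLeft_iff.1 hx
      simpa [mul_assoc] using (wordProd_placticVar_eq (.unbarred_zyy _ _ hyz)).symm
    · exact absurd hz (by simpa using hx)
  swap_right {x y z} hyx hyz := by
    obtain hyz | ⟨rfl, hy⟩ := not_colGT_iff.1 hyz <;> obtain hxy | ⟨rfl, hy'⟩ := hyx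
    · simpa [mul_assoc] using wordProd_placticVar_eq (.yxz_yzx _ _ _ hxy hyz)
    · obtain ⟨b, rfl⟩ := Sum.isRight_iff.1 hy'
      simpa [mul_assoc] using wordProd_placticVar_eq (.barred_yyz _ _ hyz)
    · obtain ⟨b, rfl⟩ := Sum.isLeft_iff.1 hy
      simpa [mul_assoc] using (wordProd_placticVar_eq (.unbarred_yyx _ _ hxy)).symm
    · exact absurd hy' (by simpa using hy)

theorem commute_toPlactic_elementary (k l : ℤ) :
    Commute (toPlactic lt (elementary lt k)) (toPlactic lt (elementary lt l)) := by
  simp only [toPlactic_elementary]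
  obtain hk | hk := lt_or_ge k 0
  · simp [columnsInt_of_neg hk]
  obtain hl | hl := lt_or_ge l 0
  · simp [columnsInt_of_neg hl]
  lift k to ℕ using hk
  lift l to ℕ using hl
  exact commute_columnSum knuthRelations_placticVar (fun _ _ => Finset.subset_univ _) k l

/-- The commutation of the elementary functions makes it possible to permute the columns instead of
the corrections of their lengths. -/
theorem toPlactic_superSchur (ν : YoungDiagram) :
    toPlactic lt (superSchur lt ν) = ∑ σ : Equiv.Perm (Fin (ν.rowLen 0)),
      ((Equiv.Perm.sign σ : ℤˣ) : ℤ) • (List.ofFn fun j => toPlactic lt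
        (elementary lt ((ν.colLen (σ j) : ℤ) - ((σ j : ℕ) : ℤ) + ((j : ℕ) : ℤ)))).prod := by
  rw [superSchur, map_sum, ← Equiv.sum_comp (Equiv.inv (Equiv.Perm (Fin (ν.rowLen 0))))]
  refine Finset.sum_congr rfl fun σ _ => ?_
  rw [Equiv.inv_apply, Equiv.Perm.sign_inv, map_zsmul, map_list_prod, List.map_ofFn]
  congr 1
  refine ((Equiv.Perm.ofFn_comp_perm σ _).prod_eq' ?_).symm.trans ?_
  · rw [List.pairwise_ofFn]
    exact fun _ _ _ => commute_toPlactic_elementary _ _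
  · congr 2
    funext j
    have hσ : σ⁻¹ (σ j) = j := σ.symm_apply_apply j
    rw [Function.comp_apply, Function.comp_apply, hσ]
    congr 2
    ring

theorem isColoredTableau_iff {ν : YoungDiagram} {T : ν.cells → Letter N} :
    IsColoredTableau lt ν T ↔
      (∀ c d : ν.cells, c.1.2 = d.1.2 → c.1.1 < d.1.1 → ColGT lt (T d) (T c)) ∧
      (∀ c d : ν.cells, c.1.1 = d.1.1 → c.1.2 < d.1.2 → ¬ ColGT lt (T c) (T d)) := by
  simp only [not_colGT_iff]
  constructor
  · refine fun h => ⟨fun c d hj hi => ?_, fun c d hi hj => ?_⟩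
    · refine (h.col_weak c d hj hi).imp_right fun heq => ⟨heq.symm, ?_⟩
      by_contra hr
      have hl : (T d).isLeft = true := by simpa using hr
      exact irrefl_of lt _ (heq ▸ h.col_strict c d hj hi (heq ▸ hl) hl)
    · refine (h.row_weak c d hi hj).imp_right fun heq => ⟨heq, ?_⟩
      by_contra hl
      have hr : (T c).isRight = true := by simpa using hl
      exact irrefl_of lt _ (heq ▸ h.row_strict c d hi hj hr (heq ▸ hr))
  · rintro ⟨hcol, hrow⟩
    exact {
      row_weak := fun c d hi hj => (hrow c d hi hj).imp_right And.left
      col_weak := fun c d hj hi => (hcol c d hj hi).imp_right fun h => h.1.symm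
      row_strict := fun c d hi hj hc _ => (hrow c d hi hj).resolve_right fun h =>
        (by simpa using h.2 : ¬ (T c).isRight = true) hc
      col_strict := fun c d hj hi _ hd => (hcol c d hj hi).resolve_right fun h =>
        (by simpa using h.2 : ¬ (T d).isLeft = true) hd }

end Plactic

end SuperSchur

theorem theorem3p5_general {N : ℕ} (lt : SuperSchur.Letter N → SuperSchur.Letter N → Prop)
    [IsStrictTotalOrder (SuperSchur.Letter N) lt] (ν : YoungDiagram) :
    SuperSchur.toPlactic lt (SuperSchur.superSchur lt ν) =
      ∑ T ∈ SuperSchur.coloredTableaux lt ν,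
        SuperSchur.toPlactic lt (SuperSchur.monomial (SuperSchur.columnReading T)) := by
  classical
  have hγ : StrictAnti fun j : Fin (ν.rowLen 0) => (ν.colLen j : ℤ) - ((j : ℕ) : ℤ) := by
    intro i j hij
    have hcol := ν.colLen_anti i j hij.le
    simp only
    omega
  have hsum := SuperSchur.sum_sign_prod_eq_sum_isTableauTuple
    (SuperSchur.knuthRelations_placticVar (lt := lt)) hγ
  simp only [sub_add_cancel] at hsum
  rw [SuperSchur.toPlactic_superSchur]
  simp only [SuperSchur.toPlactic_elementary]
  rw [hsum, SuperSchur.sum_columnTuples_isTableauTuple]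
  simp only [SuperSchur.coloredTableaux, SuperSchur.isColoredTableau_iff,
    SuperSchur.toPlactic_columnReading]

theorem theorem3p5 {N : ℕ} (lt : SuperSchur.Letter N → SuperSchur.Letter N → Prop)
    (hlt : SuperSchur.IsShuffleOrder lt) (ν : YoungDiagram) :
    SuperSchur.toPlactic lt (SuperSchur.superSchur lt ν) =
      ∑ T ∈ SuperSchur.coloredTableaux lt ν,
        SuperSchur.toPlactic lt (SuperSchur.monomial (SuperSchur.columnReading T)) :=
  have := hlt.isStrictTotalOrder
  theorem3p5_general lt ν
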